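/- Let $d\ge 1$ be an integer, $p\in[0,1]$, and let $\psi^+$ denote the projector onto $\frac1{\sqrt d}\sum_{i=1}^d|ii\rangle$. In the two-input CNS-QRAC game Alice holds two $d$-dimensional input systems $A_1,A_2$. Alice and Bob share an arbitrary (pure or mixed) state $\rho_{\widetilde A B}$, where $B$ has dimension $d$ and $\widetilde A$ has arbitrary finite dimension. Alice performs a measurement (POVM) $\{M^{(i)}_{A_1A_2\widetilde A}\}_{i=1}^K$ with an arbitrary finite number $K$ of outcomes and sends the outcome $i$ to Bob. If Bob is to recover input $x\in\{1,2\}$, he applies a unitary $U_B^{(i,x)}$ to $B$. The fidelity for input $x$ is the entanglement fidelity: with $A_1,A_2$ maximally entangled with reference systems $A_1',A_2'$, $$F_x=\sum_{i=1}^K\operatorname{tr}\Big[\psi^+_{A'_xB}\,U_B^{(i,x)}M^{(i)}_{A_1A_2\widetilde A}\big(\psi^+_{A_1'A_1}\otimes\psi^+_{A_2'A_2}\otimes\rho_{\widetilde AB}\big)U_B^{(i,x)\dagger}\Big].$$ If input $1$ is requested with probability $p$ and input $2$ with probability $1-p$, the success probability is $P_{\rm succ}=p\,F_1+(1-p)\,F_2$.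 Then every such strategy satisfies $$P_{\rm succ}\le \frac12\left(1+\sqrt{1+\frac{4(d^2-1)(p-1)p}{d^2}}\right).$$ Moreover, the right-hand side is the maximum of $p\,x_1^2+(1-p)\,x_2^2$ over all $x_1,x_2\in[0,1]$ satisfying the asymmetric-cloning monogamy constraint $$x_1^2+x_2^2\le\frac{d-1}{d}+\frac{1}{d+1}(x_1+x_2)^2 .$$ -/

import Mathlib

open scoped Matrix Kronecker ComplexOrder

namespace CNSQRAC

noncomputable section

/-- The vector of the maximally entangled state `(1 / √d) ∑ i, |i i⟩` of two `d`-level systems. -/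
def maxEntVec (d : ℕ) : Fin d × Fin d → ℂ :=
  fun ij => if ij.1 = ij.2 then ((1 / Real.sqrt (d : ℝ) : ℝ) : ℂ) else 0

/-- The maximally entangled state as a density matrix, `|ψ⁺⟩⟨ψ⁺|`. -/
def maxEnt (d : ℕ) : Matrix (Fin d × Fin d) (Fin d × Fin d) ℂ :=
  Matrix.vecMulVec (maxEntVec d) (star (maxEntVec d))

/-- The singlet fraction (entanglement fidelity) `tr (ψ⁺ σ) = ⟨ψ⁺| σ |ψ⁺⟩` of a bipartite state. -/
def singletFraction {d : ℕ} (σ : Matrix (Fin d × Fin d) (Fin d × Fin d) ℂ) : ℝ :=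
  (maxEnt d * σ).trace.re

/-- A strategy in the two-input game. Alice holds the two input systems `A₁`, `A₂` (each of
dimension `d`) and her half `Ã` (dimension `m`) of a shared state; Bob holds the other half `B`
(dimension `d`). Alice measures `A₁ A₂ Ã` jointly, sends the outcome `i` (one of `K`) to Bob, and
Bob, who wants to recover the input `x`, applies the unitary `U i x` to `B`. -/
structure Strategy (d m K : ℕ) where
  /-- The shared state on `Ã B`. -/
  shared : Matrix (Fin m × Fin d) (Fin m × Fin d) ℂ
  shared_posSemidef : shared.PosSemidef
  shared_trace : shared.trace = 1
  /-- Alice's measurement on `(A₁ A₂) Ã`. -/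
  povm : Fin K → Matrix ((Fin d × Fin d) × Fin m) ((Fin d × Fin d) × Fin m) ℂ
  povm_posSemidef : ∀ i, (povm i).PosSemidef
  povm_sum : ∑ i, povm i = 1
  /-- Bob's corrections, depending on the message and on the input he wants to recover. -/
  unitary : Fin K → Fin 2 → Matrix.unitaryGroup (Fin d) ℂ

/-- `ψ⁺_{A₁' A₁} ⊗ ψ⁺_{A₂' A₂}`, with the systems ordered as `(A₁' A₂') (A₁ A₂)`: each input of
Alice is maximally entangled with its own reference system. -/
def inputState (d : ℕ) :
    Matrix ((Fin d × Fin d) × (Fin d × Fin d)) ((Fin d × Fin d) × (Fin d × Fin d)) ℂ :=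
  (maxEnt d ⊗ₖ maxEnt d).submatrix
    (fun g => ((g.1.1, g.2.1), (g.1.2, g.2.2))) (fun g => ((g.1.1, g.2.1), (g.1.2, g.2.2)))

/-- The operator `1_{A'} ⊗ M_{A Ã} ⊗ 1_B`, with the systems ordered as `(A' A) (Ã B)`, where
`A' = A₁' A₂'` and `A = A₁ A₂`. -/
def liftAlice {d m : ℕ} (M : Matrix ((Fin d × Fin d) × Fin m) ((Fin d × Fin d) × Fin m) ℂ) :
    Matrix (((Fin d × Fin d) × (Fin d × Fin d)) × (Fin m × Fin d))
      (((Fin d × Fin d) × (Fin d × Fin d)) × (Fin m × Fin d)) ℂ :=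
  ((1 : Matrix ((Fin d × Fin d) × Fin d) ((Fin d × Fin d) × Fin d) ℂ) ⊗ₖ M).submatrix
    (fun g => ((g.1.1, g.2.2), (g.1.2, g.2.1))) (fun g => ((g.1.1, g.2.2), (g.1.2, g.2.1)))

/-- The partial trace over `A` and `Ã` of an operator on `(A' A) (Ã B)`. -/
def traceAlice {d m : ℕ}
    (X : Matrix (((Fin d × Fin d) × (Fin d × Fin d)) × (Fin m × Fin d))
      (((Fin d × Fin d) × (Fin d × Fin d)) × (Fin m × Fin d)) ℂ) :
    Matrix ((Fin d × Fin d) × Fin d) ((Fin d × Fin d) × Fin d) ℂ :=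
  Matrix.of fun g h => ∑ a : Fin d × Fin d, ∑ t : Fin m, X ((g.1, a), (t, g.2)) ((h.1, a), (t, h.2))

/-- The marginal on `A_x' B` of an operator on `(A₁' A₂') B`; the value `0` of `x` stands for the
first input and the value `1` for the second. -/
def marginal {d : ℕ} (x : Fin 2)
    (X : Matrix ((Fin d × Fin d) × Fin d) ((Fin d × Fin d) × Fin d) ℂ) :
    Matrix (Fin d × Fin d) (Fin d × Fin d) ℂ :=
  Matrix.of fun g h =>
    if x = 0 then ∑ c : Fin d, X ((g.1, c), g.2) ((h.1, c), h.2)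
    else ∑ c : Fin d, X ((c, g.1), g.2) ((c, h.1), h.2)

namespace Strategy

variable {d m K : ℕ}

/-- The unnormalised state of `A' B` after Alice has obtained the outcome `i`:
`tr_{A Ã} [(1 ⊗ M_i ⊗ 1) (ψ⁺_{A' A} ⊗ ρ_{Ã B})]`. -/
def afterOutcome (S : Strategy d m K) (i : Fin K) :
    Matrix ((Fin d × Fin d) × Fin d) ((Fin d × Fin d) × Fin d) ℂ :=
  traceAlice (liftAlice (S.povm i) * (inputState d ⊗ₖ S.shared))

/-- The final state of `A' B` when Bob wants to recover the input `x`: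
`∑ i, (1 ⊗ U_i^x) ω_i (1 ⊗ U_i^x)†`, where `ω_i` is the state after the outcome `i`. -/
def finalState (S : Strategy d m K) (x : Fin 2) :
    Matrix ((Fin d × Fin d) × Fin d) ((Fin d × Fin d) × Fin d) ℂ :=
  ∑ i, ((1 : Matrix (Fin d × Fin d) (Fin d × Fin d) ℂ) ⊗ₖ (S.unitary i x : Matrix (Fin d) (Fin d) ℂ))
    * S.afterOutcome i
    * ((1 : Matrix (Fin d × Fin d) (Fin d × Fin d) ℂ) ⊗ₖ
        (S.unitary i x : Matrix (Fin d) (Fin d) ℂ))ᴴ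

/-- The entanglement fidelity with which Bob recovers the input `x`. -/
def fidelity (S : Strategy d m K) (x : Fin 2) : ℝ :=
  singletFraction (marginal x (S.finalState x))

/-- The success probability when the first input is requested with probability `p` and the second
one with probability `1 - p`. -/
def successProb (S : Strategy d m K) (p : ℝ) : ℝ :=
  p * S.fidelity 0 + (1 - p) * S.fidelity 1

end Strategy

/-- The asymmetric-cloning monogamy constraint for two clones, in the variables `x = √F₁` and
`y = √F₂` with values in `[0, 1]`. -/
def feasible (d : ℕ) : Set (ℝ × ℝ) :=
  {z | z.1 ∈ Set.Icc (0 : ℝ) 1 ∧ z.2 ∈ Set.Icc (0 : ℝ) 1 ∧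
    z.1 ^ 2 + z.2 ^ 2 ≤ ((d : ℝ) - 1) / d + 1 / (2 + (d : ℝ) - 1) * (z.1 + z.2) ^ 2}

/-- `½ (1 + √(1 + 4 (d² - 1) (p - 1) p / d²))`. -/
def bound (d : ℕ) (p : ℝ) : ℝ :=
  1 / 2 * (1 + Real.sqrt (1 + 4 * ((d : ℝ) ^ 2 - 1) * (p - 1) * p / (d : ℝ) ^ 2))

end

end CNSQRAC

namespace CNSQRAC

/-! For each outcome, the contribution to $F_x$ is the trace of the unnormalised state against a
projection $V_xV_x^\dagger$, where $V_x$ is an isometry depending on Bob's correction. The overlap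
$V_0^\dagger V_1$ is $c=1/d$ times a unitary (`embed_conjTranspose_mul_mul_embed`), so
$pV_0V_0^\dagger+(1-p)V_1V_1^\dagger\le l$, where $l$ is the larger root of $l^2-l+(1-c^2)p(1-p)=0$
(`posSemidef_smul_one_sub_of_isometry`). This $l$ is `bound d p`. The outcome states have total
trace $1$, so summing over outcomes gives the bound. The monogamy constraint says that the Gram
determinant $1-x^2-y^2-c^2+2cxy$ of three unit vectors with overlaps $x,y,c$ is nonnegative. Its
optimum is thus the same eigenvalue problem, for two vectors with overlap $c$. -/

/-! ### The optimisation over the monogamy region -/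

theorem bound_spec {d : ℕ} (hd : 1 ≤ d) (p : ℝ) :
    0 < 2 * bound d p - 1 ∧
      (2 * bound d p - 1) ^ 2 = (1 / (d : ℝ)) ^ 2 + (1 - (1 / (d : ℝ)) ^ 2) * (2 * p - 1) ^ 2 := by
  have hd' : (1 : ℝ) ≤ d := by exact_mod_cast hd
  have hc : 0 < 1 / (d : ℝ) := by positivity
  have hc1 : 1 / (d : ℝ) ≤ 1 := by rw [div_le_one (by positivity)]; exact hd'
  have hS : 2 * bound d p - 1 =
      Real.sqrt ((1 / (d : ℝ)) ^ 2 + (1 - (1 / (d : ℝ)) ^ 2) * (2 * p - 1) ^ 2) := by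
    have : 1 + 4 * ((d : ℝ) ^ 2 - 1) * (p - 1) * p / (d : ℝ) ^ 2 =
        (1 / (d : ℝ)) ^ 2 + (1 - (1 / (d : ℝ)) ^ 2) * (2 * p - 1) ^ 2 := by
      field_simp
      ring
    rw [bound, this]
    ring
  have hpos : 0 < (1 / (d : ℝ)) ^ 2 + (1 - (1 / (d : ℝ)) ^ 2) * (2 * p - 1) ^ 2 := by
    have : 0 ≤ 1 - (1 / (d : ℝ)) ^ 2 := by nlinarith
    positivity
  rw [hS]
  exact ⟨Real.sqrt_pos.2 hpos, Real.sq_sqrt hpos.le⟩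

theorem mem_feasible_iff {d : ℕ} (hd : 1 ≤ d) (z : ℝ × ℝ) :
    z ∈ feasible d ↔ z.1 ∈ Set.Icc (0 : ℝ) 1 ∧ z.2 ∈ Set.Icc (0 : ℝ) 1 ∧
      z.1 ^ 2 + z.2 ^ 2 - 2 * (1 / (d : ℝ)) * z.1 * z.2 ≤ 1 - (1 / (d : ℝ)) ^ 2 := by
  have hd' : (1 : ℝ) ≤ d := by exact_mod_cast hd
  have key : 1 - (1 / (d : ℝ)) ^ 2 - (z.1 ^ 2 + z.2 ^ 2 - 2 * (1 / (d : ℝ)) * z.1 * z.2) =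
      ((d : ℝ) + 1) / d * (((d : ℝ) - 1) / d + 1 / (2 + (d : ℝ) - 1) * (z.1 + z.2) ^ 2 -
        (z.1 ^ 2 + z.2 ^ 2)) := by
    have : 2 + (d : ℝ) - 1 = d + 1 := by ring
    rw [this]
    field_simp
    ring
  have hpos : 0 < ((d : ℝ) + 1) / d := by positivity
  simp only [feasible, Set.mem_ofPred_eq]
  refine and_congr_right fun _ => and_congr_right fun _ => ?_
  rw [← sub_nonneg, ← sub_nonneg (b := _ - _), key, mul_nonneg_iff_of_pos_left hpos]

theorem le_bound_of_mem_feasible {d : ℕ} (hd : 1 ≤ d) {p : ℝ} (hp : p ∈ Set.Icc (0 : ℝ) 1)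
    {z : ℝ × ℝ} (hz : z ∈ feasible d) : p * z.1 ^ 2 + (1 - p) * z.2 ^ 2 ≤ bound d p := by
  obtain ⟨hS, hS2⟩ := bound_spec hd p
  obtain ⟨⟨hx0, hx1⟩, ⟨hy0, hy1⟩, hxy⟩ := (mem_feasible_iff hd z).1 hz
  obtain ⟨x, y⟩ := z
  simp only at *
  have hd' : (1 : ℝ) ≤ d := by exact_mod_cast hd
  have hc : 0 < 1 / (d : ℝ) := by positivity
  have hc1 : 1 / (d : ℝ) ≤ 1 := by rw [div_le_one (by positivity)]; exact hd'
  generalize 1 / (d : ℝ) = c at *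
  generalize bound d p = l at *
  obtain ⟨hp0, hp1⟩ := hp
  rcases hc1.eq_or_lt with rfl | hc1
  -- For $d=1$ the factor $1-c^2$ vanishes, and the bound is trivial.
  · have hl : l = 1 := by nlinarith
    nlinarith [mul_nonneg hp0 (by nlinarith : 0 ≤ 1 - x ^ 2),
      mul_nonneg (sub_nonneg.2 hp1) (by nlinarith : 0 ≤ 1 - y ^ 2)]
  · have hk : 0 < 1 - c ^ 2 := by nlinarith
    have hl : 0 < l := by linarith
    -- The form $l(x^2+y^2-2cxy)-(1-c^2)(px^2+(1-p)y^2)$ has determinant zero, so a positive leading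
    -- coefficient makes it a multiple of a square.
    have hdet : (l - (1 - c ^ 2) * p) * (l - (1 - c ^ 2) * (1 - p)) = (l * c) ^ 2 := by
      linear_combination (1 - c ^ 2) / 4 * hS2
    have hsum : 0 < (l - (1 - c ^ 2) * p) + (l - (1 - c ^ 2) * (1 - p)) := by nlinarith
    have hprod : 0 < (l - (1 - c ^ 2) * p) * (l - (1 - c ^ 2) * (1 - p)) := by
      rw [hdet]; positivity
    have hA : 0 < l - (1 - c ^ 2) * p := by
      by_contra! h
      nlinarith
    have hform : 0 ≤ (l - (1 - c ^ 2) * p) * (l * (x ^ 2 + y ^ 2 - 2 * c * x * y) -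
        (1 - c ^ 2) * (p * x ^ 2 + (1 - p) * y ^ 2)) := by
      have := sq_nonneg ((l - (1 - c ^ 2) * p) * x - l * c * y)
      linear_combination this - y ^ 2 * hdet
    have h1 := nonneg_of_mul_nonneg_right hform hA
    have h2 : (1 - c ^ 2) * (p * x ^ 2 + (1 - p) * y ^ 2) ≤ (1 - c ^ 2) * l := by
      nlinarith
    exact le_of_mul_le_mul_left h2 hk

theorem exists_mem_feasible_eq_bound {d : ℕ} (hd : 1 ≤ d) {p : ℝ} (hp : p ∈ Set.Icc (0 : ℝ) 1) :
    ∃ z ∈ feasible d, p * z.1 ^ 2 + (1 - p) * z.2 ^ 2 = bound d p := by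
  obtain ⟨hS, hS2⟩ := bound_spec hd p
  have hd' : (1 : ℝ) ≤ d := by exact_mod_cast hd
  have hc : 0 < 1 / (d : ℝ) := by positivity
  have hc1 : 1 / (d : ℝ) ≤ 1 := by rw [div_le_one (by positivity)]; exact hd'
  have hfeas := mem_feasible_iff hd
  generalize 1 / (d : ℝ) = c at *
  obtain ⟨hp0, hp1⟩ := hp
  have hl : bound d p = 1 / 2 * (1 + (2 * bound d p - 1)) := by ring
  rw [hl]
  generalize 2 * bound d p - 1 = S at *
  have hk : 0 ≤ 1 - c ^ 2 := by nlinarith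
  have hkc : 0 ≤ (1 - c ^ 2) * (c ^ 2) := by positivity
  have hpm : 0 ≤ p * (1 - p) := mul_nonneg hp0 (sub_nonneg.2 hp1)
  -- Convexity of the square: $S^2$ is the average of $1$ and $e^2$ with weights $c^2$ and $1-c^2$.
  have habs : ∀ e : ℝ, e ^ 2 = (2 * p - 1) ^ 2 → |c ^ 2 + (1 - c ^ 2) * e| ≤ S := by
    intro e he
    refine abs_le_of_sq_le_sq ?_ hS.le
    rw [hS2, ← he]
    nlinarith [mul_nonneg hkc (sq_nonneg (1 - e))]
  have hX : ∀ e : ℝ, e ^ 2 = (2 * p - 1) ^ 2 →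
      0 ≤ 1 / 2 * (1 + (c ^ 2 + (1 - c ^ 2) * e) / S) ∧
        1 / 2 * (1 + (c ^ 2 + (1 - c ^ 2) * e) / S) ≤ 1 := by
    intro e he
    obtain ⟨h1, h2⟩ := abs_le.1 (habs e he)
    have h3 : (c ^ 2 + (1 - c ^ 2) * e) / S ≤ 1 := (div_le_one hS).2 h2
    have h4 : -1 ≤ (c ^ 2 + (1 - c ^ 2) * e) / S := by rw [le_div_iff₀ hS]; linarith
    constructor <;> linarith
  obtain ⟨hx0, hx1⟩ := hX (2 * p - 1) rfl
  obtain ⟨hy0, hy1⟩ := hX (-(2 * p - 1)) (by ring)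
  -- For unit vectors $v,w$ with overlap $c$, these are the overlaps of $v$ and $w$ with the top
  -- eigenvector of $p\,vv^\dagger+(1-p)\,ww^\dagger$. Three coplanar vectors have zero Gram
  -- determinant, so the constraint is tight.
  refine ⟨(Real.sqrt (1 / 2 * (1 + (c ^ 2 + (1 - c ^ 2) * (2 * p - 1)) / S)),
    Real.sqrt (1 / 2 * (1 + (c ^ 2 + (1 - c ^ 2) * (-(2 * p - 1))) / S))), ?_, ?_⟩
  · rw [hfeas]
    refine ⟨⟨Real.sqrt_nonneg _, Real.sqrt_le_one.2 hx1⟩,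
      ⟨Real.sqrt_nonneg _, Real.sqrt_le_one.2 hy1⟩, ?_⟩
    simp only
    rw [mul_assoc, ← Real.sqrt_mul hx0, Real.sq_sqrt hx0, Real.sq_sqrt hy0]
    have hprod : 1 / 2 * (1 + (c ^ 2 + (1 - c ^ 2) * (2 * p - 1)) / S) *
        (1 / 2 * (1 + (c ^ 2 + (1 - c ^ 2) * (-(2 * p - 1))) / S)) =
        (c * (1 + S) / (2 * S)) ^ 2 := by
      field_simp
      linear_combination (1 - c ^ 2) * hS2
    rw [hprod, Real.sqrt_sq (by positivity)]
    apply le_of_eq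
    field_simp
    ring
  · simp only
    rw [Real.sq_sqrt hx0, Real.sq_sqrt hy0]
    field_simp
    linear_combination -hS2

theorem isGreatest_bound {d : ℕ} (hd : 1 ≤ d) {p : ℝ} (hp : p ∈ Set.Icc (0 : ℝ) 1) :
    IsGreatest ((fun z : ℝ × ℝ => p * z.1 ^ 2 + (1 - p) * z.2 ^ 2) '' feasible d) (bound d p) := by
  refine ⟨exists_mem_feasible_eq_bound hd hp, ?_⟩
  rintro _ ⟨z, hz, rfl⟩
  exact le_bound_of_mem_feasible hd hp hz

/-! ### The operator inequality for two isometries -/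

open Matrix
open scoped MatrixOrder

/-- The trace of a product of two positive semidefinite matrices is nonnegative. -/
theorem trace_mul_nonneg_of_posSemidef {n : Type*} [Fintype n] [DecidableEq n]
    {A B : Matrix n n ℂ} (hA : A.PosSemidef) (hB : B.PosSemidef) : 0 ≤ (A * B).trace := by
  obtain ⟨C, rfl⟩ := CStarAlgebra.nonneg_iff_eq_star_mul_self.1 hA.nonneg
  rw [star_eq_conjTranspose, Matrix.mul_assoc, trace_mul_comm]
  exact (hB.mul_mul_conjTranspose_same C).trace_nonneg

/-- A weighted sum of the range projections of two isometries whose overlap is `c` times a unitary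
is bounded by the larger root `l` of `l ^ 2 - l + (1 - c ^ 2) * p * q`. -/
theorem posSemidef_smul_one_sub_of_isometry {n k : Type*} [Fintype n] [DecidableEq n] [Fintype k]
    [DecidableEq k] {V W : Matrix n k ℂ} {X : Matrix k k ℂ} {c p q l : ℝ}
    (hV : Vᴴ * V = 1) (hW : Wᴴ * W = 1) (hVW : Vᴴ * W = (c : ℂ) • X) (hX : X * Xᴴ = 1)
    (hc : 0 ≤ c) (hp : 0 ≤ p) (hq : 0 ≤ q) (hl : 0 < l) (hpl : p ≤ l) (hql : q ≤ l)
    (h : (l - p) * (l - q) = p * q * c ^ 2) :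
    ((l : ℂ) • (1 : Matrix n n ℂ) - ((p : ℂ) • (V * Vᴴ) + (q : ℂ) • (W * Wᴴ))).PosSemidef := by
  -- The weights are chosen so that the cross terms of $ZZ^\dagger$ cancel those of $HH^\dagger$,
  -- leaving $HH^\dagger+ZZ^\dagger=lH$.
  set r := Real.sqrt (p * (l - p)) with hr
  set s := Real.sqrt (q * (l - q)) with hs
  have hr2 : (r : ℂ) * r = p * (l - p) := by
    exact_mod_cast Real.mul_self_sqrt (mul_nonneg hp (sub_nonneg.2 hpl))
  have hs2 : (s : ℂ) * s = q * (l - q) := by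
    exact_mod_cast Real.mul_self_sqrt (mul_nonneg hq (sub_nonneg.2 hql))
  have hrs : (r : ℂ) * s = p * q * c := by
    have : r * s = p * q * c := by
      rw [hr, hs, ← Real.sqrt_mul (mul_nonneg hp (sub_nonneg.2 hpl)),
        show p * (l - p) * (q * (l - q)) = (p * q * c) ^ 2 by linear_combination p * q * h,
        Real.sqrt_sq (by positivity)]
    exact_mod_cast this
  set H := (l : ℂ) • (1 : Matrix n n ℂ) - ((p : ℂ) • (V * Vᴴ) + (q : ℂ) • (W * Wᴴ)) with hH
  set Z := (r : ℂ) • (V * X) - (s : ℂ) • W with hZ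
  have hWV : Wᴴ * V = (c : ℂ) • Xᴴ := by
    rw [← conjTranspose_conjTranspose V, ← conjTranspose_mul, hVW]
    simp
  have hHH : Hᴴ = H := by simp [hH]
  have hVV : V * Vᴴ * (V * Vᴴ) = V * Vᴴ := by
    rw [Matrix.mul_assoc, ← Matrix.mul_assoc Vᴴ, hV, Matrix.one_mul]
  have hWW : W * Wᴴ * (W * Wᴴ) = W * Wᴴ := by
    rw [Matrix.mul_assoc, ← Matrix.mul_assoc Wᴴ, hW, Matrix.one_mul]
  have hVVWW : V * Vᴴ * (W * Wᴴ) = (c : ℂ) • (V * X * Wᴴ) := by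
    rw [Matrix.mul_assoc, ← Matrix.mul_assoc Vᴴ, hVW]
    simp [Matrix.mul_assoc]
  have hWWVV : W * Wᴴ * (V * Vᴴ) = (c : ℂ) • (W * (Xᴴ * Vᴴ)) := by
    rw [Matrix.mul_assoc, ← Matrix.mul_assoc Wᴴ, hWV]
    simp
  have hHsq : H * Hᴴ = ((l : ℂ) * l) • (1 : Matrix n n ℂ) + ((p : ℂ) * p - 2 * l * p) • (V * Vᴴ) +
      ((q : ℂ) * q - 2 * l * q) • (W * Wᴴ) + ((p : ℂ) * q * c) • (V * X * Wᴴ) +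
      ((p : ℂ) * q * c) • (W * (Xᴴ * Vᴴ)) := by
    rw [hHH, hH]
    simp only [Matrix.sub_mul, Matrix.mul_sub, Matrix.add_mul, Matrix.mul_add, Matrix.smul_mul,
      Matrix.mul_smul, Matrix.one_mul, Matrix.mul_one, hVV, hWW, hVVWW, hWWVV]
    module
  have hZsq : Z * Zᴴ = ((r : ℂ) * r) • (V * Vᴴ) + ((s : ℂ) * s) • (W * Wᴴ) -
      ((r : ℂ) * s) • (V * X * Wᴴ) - ((r : ℂ) * s) • (W * (Xᴴ * Vᴴ)) := by
    have hVX : V * X * (Xᴴ * Vᴴ) = V * Vᴴ := by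
      rw [Matrix.mul_assoc, ← Matrix.mul_assoc X, hX, Matrix.one_mul]
    rw [hZ]
    simp only [conjTranspose_sub, conjTranspose_smul, conjTranspose_mul, Matrix.sub_mul,
      Matrix.mul_sub, Matrix.smul_mul, Matrix.mul_smul, hVX, Complex.star_def, Complex.conj_ofReal]
    module
  have hlC : (l : ℂ) ≠ 0 := by exact_mod_cast hl.ne'
  have key : H = ((l⁻¹ : ℝ) : ℂ) • (H * Hᴴ + Z * Zᴴ) := by
    have : H * Hᴴ + Z * Zᴴ = (l : ℂ) • H := by
      rw [hHsq, hZsq, hr2, hs2, hrs, hH]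
      module
    rw [this, smul_smul, Complex.ofReal_inv, inv_mul_cancel₀ hlC, one_smul]
  rw [key]
  refine PosSemidef.smul ((posSemidef_self_mul_conjTranspose H).add
    (posSemidef_self_mul_conjTranspose Z)) ?_
  exact_mod_cast (inv_pos.2 hl).le

/-! ### Traces and partial traces -/

/-- The regrouping `(A' A) (Ã B) ≃ (A' B) (A Ã)`. -/
def regroup (d m : ℕ) :
    ((Fin d × Fin d) × (Fin d × Fin d)) × (Fin m × Fin d) ≃
      ((Fin d × Fin d) × Fin d) × ((Fin d × Fin d) × Fin m) where
  toFun g := ((g.1.1, g.2.2), (g.1.2, g.2.1))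
  invFun g := ((g.1.1, g.2.1), (g.2.2, g.1.2))
  left_inv _ := rfl
  right_inv _ := rfl

theorem trace_submatrix_equiv {m n : Type*} [Fintype m] [Fintype n] (A : Matrix n n ℂ) (e : m ≃ n) :
    (A.submatrix e e).trace = A.trace :=
  e.sum_comp fun i => A i i

theorem liftAlice_eq {d m : ℕ} (M : Matrix ((Fin d × Fin d) × Fin m) ((Fin d × Fin d) × Fin m) ℂ) :
    liftAlice M = ((1 : Matrix ((Fin d × Fin d) × Fin d) ((Fin d × Fin d) × Fin d) ℂ) ⊗ₖ M).submatrix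
      (regroup d m) (regroup d m) := rfl

/-- Partial trace is dual to tensoring with the identity. -/
theorem trace_mul_partialTrace {m n : Type*} [Fintype m] [Fintype n] [DecidableEq n]
    (Y : Matrix m m ℂ) (X : Matrix (m × n) (m × n) ℂ) :
    (Y * Matrix.of fun g h => ∑ u, X (g, u) (h, u)).trace =
      ((Y ⊗ₖ (1 : Matrix n n ℂ)) * X).trace := by
  simp only [trace, diag_apply, Matrix.mul_apply, of_apply, Fintype.sum_prod_type,
    kroneckerMap_apply, one_apply, Finset.mul_sum]
  refine Finset.sum_congr rfl fun g _ => ?_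
  rw [Finset.sum_comm]
  simp

theorem trace_mul_traceAlice {d m : ℕ}
    (Y : Matrix ((Fin d × Fin d) × Fin d) ((Fin d × Fin d) × Fin d) ℂ)
    (X : Matrix (((Fin d × Fin d) × (Fin d × Fin d)) × (Fin m × Fin d))
      (((Fin d × Fin d) × (Fin d × Fin d)) × (Fin m × Fin d)) ℂ) :
    (Y * traceAlice X).trace =
      ((Y ⊗ₖ (1 : Matrix ((Fin d × Fin d) × Fin m) ((Fin d × Fin d) × Fin m) ℂ)).submatrix
        (regroup d m) (regroup d m) * X).trace := by
  have hX : X = (X.submatrix (regroup d m).symm (regroup d m).symm).submatrix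
      (regroup d m) (regroup d m) := by simp
  have hT : traceAlice X = Matrix.of fun g h => ∑ u : (Fin d × Fin d) × Fin m,
      X.submatrix (regroup d m).symm (regroup d m).symm (g, u) (h, u) := by
    ext g h
    simp only [traceAlice, of_apply, Fintype.sum_prod_type]
    rfl
  rw [hT]
  conv_rhs => rw [hX]
  generalize X.submatrix (regroup d m).symm (regroup d m).symm = X'
  rw [submatrix_mul_equiv, trace_submatrix_equiv]
  exact trace_mul_partialTrace Y X'

theorem trace_mul_traceAlice_liftAlice {d m : ℕ}
    (Y : Matrix ((Fin d × Fin d) × Fin d) ((Fin d × Fin d) × Fin d) ℂ)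
    (M : Matrix ((Fin d × Fin d) × Fin m) ((Fin d × Fin d) × Fin m) ℂ)
    (R : Matrix (((Fin d × Fin d) × (Fin d × Fin d)) × (Fin m × Fin d))
      (((Fin d × Fin d) × (Fin d × Fin d)) × (Fin m × Fin d)) ℂ) :
    (Y * traceAlice (liftAlice M * R)).trace =
      ((Y ⊗ₖ M).submatrix (regroup d m) (regroup d m) * R).trace := by
  rw [trace_mul_traceAlice, liftAlice_eq, ← Matrix.mul_assoc, submatrix_mul_equiv,
    ← mul_kronecker_mul, Matrix.mul_one, Matrix.one_mul]

theorem inputState_eq (d : ℕ) : inputState d = (maxEnt d ⊗ₖ maxEnt d).submatrix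
    (Equiv.prodProdProdComm (Fin d) (Fin d) (Fin d) (Fin d))
    (Equiv.prodProdProdComm (Fin d) (Fin d) (Fin d) (Fin d)) := rfl

theorem posSemidef_inputState (d : ℕ) : (inputState d).PosSemidef :=
  ((posSemidef_vecMulVec_self_star _).kronecker (posSemidef_vecMulVec_self_star _)).submatrix _

theorem maxEntVec_apply_mul_star (d : ℕ) (i k j l : Fin d) :
    maxEntVec d (i, k) * star (maxEntVec d (j, l)) =
      if i = k then if j = l then (1 / (d : ℂ)) else 0 else 0 := by
  have : ((Real.sqrt d : ℝ) : ℂ) * (Real.sqrt d : ℝ) = d := by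
    exact_mod_cast Real.mul_self_sqrt (Nat.cast_nonneg d)
  unfold maxEntVec
  split_ifs <;> simp [← this]

theorem trace_maxEnt {d : ℕ} (hd : 1 ≤ d) : (maxEnt d).trace = 1 := by
  have : (d : ℂ) ≠ 0 := by exact_mod_cast (by omega : d ≠ 0)
  simp only [maxEnt, trace, diag_apply, vecMulVec_apply, Fintype.sum_prod_type, Pi.star_apply,
    maxEntVec_apply_mul_star]
  simp [this]

theorem trace_inputState {d : ℕ} (hd : 1 ≤ d) : (inputState d).trace = 1 := by
  rw [inputState_eq, trace_submatrix_equiv, trace_kronecker, trace_maxEnt hd, one_mul]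

/-! ### Fidelities as projections, and their overlap -/

/-- The isometry `|l⟩ ↦ ψ⁺_{A_x' B} ⊗ |l⟩` from the other reference system to `(A₁' A₂') B`. -/
noncomputable def embed (d : ℕ) (x : Fin 2) : Matrix ((Fin d × Fin d) × Fin d) (Fin d) ℂ :=
  Matrix.of fun g l =>
    if x = 0 then if g.1.2 = l then maxEntVec d (g.1.1, g.2) else 0
    else if g.1.1 = l then maxEntVec d (g.1.2, g.2) else 0

/-- By duality the test on the marginal becomes $\psi^+\otimes 1$ on the whole space, which is the
range projection of `embed d x`. -/
theorem trace_maxEnt_mul_marginal {d : ℕ} (x : Fin 2)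
    (X : Matrix ((Fin d × Fin d) × Fin d) ((Fin d × Fin d) × Fin d) ℂ) :
    (maxEnt d * marginal x X).trace = (embed d x * (embed d x)ᴴ * X).trace := by
  have rotate : ∀ f : Fin d → Fin d → Fin d → Fin d → ℂ,
      ∑ k, ∑ i, ∑ l, ∑ j, f k i l j = ∑ j, ∑ k, ∑ i, ∑ l, f k i l j := fun f =>
    (Finset.sum_congr rfl fun _ _ => (Finset.sum_congr rfl fun _ _ => Finset.sum_comm).trans
      Finset.sum_comm).trans Finset.sum_comm
  fin_cases x
  · simp [maxEnt, marginal, embed, trace, Matrix.mul_apply, vecMulVec_apply, Fintype.sum_prod_type,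
      Finset.mul_sum, apply_ite star]
    exact Finset.sum_congr rfl fun _ _ => rotate _
  · simp [maxEnt, marginal, embed, trace, Matrix.mul_apply, vecMulVec_apply, Fintype.sum_prod_type,
      Finset.mul_sum, apply_ite star]
    exact (Finset.sum_congr rfl fun _ _ => rotate _).trans Finset.sum_comm

theorem embed_conjTranspose_mul_self {d : ℕ} (hd : 1 ≤ d) (x : Fin 2) :
    (embed d x)ᴴ * embed d x = 1 := by
  have h := trace_maxEnt hd
  simp only [maxEnt, trace, diag_apply, vecMulVec_apply, Fintype.sum_prod_type, Pi.star_apply,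
    Complex.star_def, mul_comm _ ((starRingEnd ℂ) _)] at h
  ext l l'
  fin_cases x <;>
    simp [embed, Matrix.mul_apply, Fintype.sum_prod_type, apply_ite star, one_apply, h, eq_comm]

/-- Contracting two maximally entangled vectors that share only $B$ links the two references: the
normalisations give $1/d$, and passing through $\psi^+$ transposes $W$. -/
theorem embed_conjTranspose_mul_mul_embed (d : ℕ) (W : Matrix (Fin d) (Fin d) ℂ) :
    (embed d 0)ᴴ * ((1 : Matrix (Fin d × Fin d) (Fin d × Fin d) ℂ) ⊗ₖ W) * embed d 1 =
      ((1 / (d : ℝ) : ℝ) : ℂ) • Wᵀ := by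
  have hsq : ((Real.sqrt d : ℝ) : ℂ) * (Real.sqrt d : ℝ) = d := by
    exact_mod_cast Real.mul_self_sqrt (Nat.cast_nonneg d)
  ext l l'
  simp [embed, maxEntVec, Matrix.mul_apply, Fintype.sum_prod_type, apply_ite, one_apply, ← hsq]
  ring

/-! ### The bound for every strategy -/

namespace Strategy

variable {d m K : ℕ}

/-- The isometry onto the states of `A' B` on which Bob, after the outcome `i`, recovers the input
`x` perfectly. -/
noncomputable def recovery (S : Strategy d m K) (i : Fin K) (x : Fin 2) :
    Matrix ((Fin d × Fin d) × Fin d) (Fin d) ℂ :=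
  ((1 : Matrix (Fin d × Fin d) (Fin d × Fin d) ℂ) ⊗ₖ
    (S.unitary i x : Matrix (Fin d) (Fin d) ℂ))ᴴ * embed d x

theorem unitary_mul_conjTranspose (S : Strategy d m K) (i : Fin K) (x : Fin 2) :
    (S.unitary i x : Matrix (Fin d) (Fin d) ℂ) * (S.unitary i x : Matrix (Fin d) (Fin d) ℂ)ᴴ = 1 :=
  mem_unitaryGroup_iff.1 (S.unitary i x).2

theorem fidelity_eq_sum (S : Strategy d m K) (x : Fin 2) :
    S.fidelity x =
      ∑ i, (S.recovery i x * (S.recovery i x)ᴴ * S.afterOutcome i).trace.re := by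
  rw [fidelity, singletFraction, trace_maxEnt_mul_marginal, finalState, Matrix.mul_sum, trace_sum,
    Complex.re_sum]
  refine Finset.sum_congr rfl fun i _ => ?_
  rw [recovery, ← Matrix.mul_assoc, trace_mul_comm]
  simp only [conjTranspose_mul, conjTranspose_conjTranspose, Matrix.mul_assoc]

theorem recovery_conjTranspose_mul (S : Strategy d m K) (i : Fin K) (x y : Fin 2) :
    (S.recovery i x)ᴴ * S.recovery i y = (embed d x)ᴴ *
      ((1 : Matrix (Fin d × Fin d) (Fin d × Fin d) ℂ) ⊗ₖ
        ((S.unitary i x : Matrix (Fin d) (Fin d) ℂ) *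
          (S.unitary i y : Matrix (Fin d) (Fin d) ℂ)ᴴ)) * embed d y := by
  have := mul_kronecker_mul (1 : Matrix (Fin d × Fin d) (Fin d × Fin d) ℂ)
    (1 : Matrix (Fin d × Fin d) (Fin d × Fin d) ℂ)
    (S.unitary i x : Matrix (Fin d) (Fin d) ℂ) (S.unitary i y : Matrix (Fin d) (Fin d) ℂ)ᴴ
  rw [Matrix.one_mul] at this
  rw [this]
  simp only [recovery, conjTranspose_mul, conjTranspose_conjTranspose, conjTranspose_kronecker,
    conjTranspose_one, Matrix.mul_assoc]

theorem sum_trace_afterOutcome (hd : 1 ≤ d) (S : Strategy d m K) :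
    ∑ i, (S.afterOutcome i).trace = 1 := by
  have h : ∀ i, (S.afterOutcome i).trace = (liftAlice (S.povm i) *
      (inputState d ⊗ₖ S.shared)).trace := fun i => by
    rw [← Matrix.one_mul (S.afterOutcome i), afterOutcome, trace_mul_traceAlice_liftAlice,
      liftAlice_eq]
  have hsum : ∑ i, liftAlice (S.povm i) = 1 := by
    have : ∑ i, liftAlice (S.povm i) = liftAlice (∑ i, S.povm i) := by
      ext g h
      simp [liftAlice, Matrix.sum_apply, Finset.mul_sum]
    rw [this, S.povm_sum, liftAlice_eq, one_kronecker_one, submatrix_one_equiv]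
  simp_rw [h]
  rw [← trace_sum, ← Matrix.sum_mul, hsum, Matrix.one_mul, trace_kronecker, trace_inputState hd,
    S.shared_trace, one_mul]

/-- This replaces positivity of the outcome state: the partial trace is moved onto $Y\otimes M_i$,
leaving a product of two positive operators. -/
theorem trace_mul_afterOutcome_nonneg (S : Strategy d m K) (i : Fin K)
    {Y : Matrix ((Fin d × Fin d) × Fin d) ((Fin d × Fin d) × Fin d) ℂ} (hY : Y.PosSemidef) :
    0 ≤ (Y * S.afterOutcome i).trace := by
  rw [afterOutcome, trace_mul_traceAlice_liftAlice]
  exact trace_mul_nonneg_of_posSemidef ((hY.kronecker (S.povm_posSemidef i)).submatrix _)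
    ((posSemidef_inputState d).kronecker S.shared_posSemidef)

theorem posSemidef_bound_sub (hd : 1 ≤ d) {p : ℝ} (hp : p ∈ Set.Icc (0 : ℝ) 1)
    (S : Strategy d m K) (i : Fin K) :
    ((bound d p : ℂ) • (1 : Matrix ((Fin d × Fin d) × Fin d) ((Fin d × Fin d) × Fin d) ℂ) -
      ((p : ℂ) • (S.recovery i 0 * (S.recovery i 0)ᴴ) +
        ((1 - p : ℝ) : ℂ) • (S.recovery i 1 * (S.recovery i 1)ᴴ))).PosSemidef := by
  obtain ⟨hS, hS2⟩ := bound_spec hd p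
  have hd' : (1 : ℝ) ≤ d := by exact_mod_cast hd
  have hc : 0 < 1 / (d : ℝ) := by positivity
  -- This quantity is $(2l-1)^2-(2p-1)^2$, so $|2p-1|\le 2l-1$, which gives both $p\le l$ and
  -- $1-p\le l$.
  have hk : 0 ≤ (1 / (d : ℝ)) ^ 2 * (1 - (2 * p - 1) ^ 2) := by
    have : 0 ≤ 1 - (2 * p - 1) ^ 2 := by nlinarith [mul_nonneg hp.1 (sub_nonneg.2 hp.2)]
    positivity
  obtain ⟨h1, h2⟩ := abs_le.1 (abs_le_of_sq_le_sq
    (by nlinarith : (2 * p - 1) ^ 2 ≤ (2 * bound d p - 1) ^ 2) hS.le)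
  have hiso : ∀ x, (S.recovery i x)ᴴ * S.recovery i x = 1 := fun x => by
    rw [recovery_conjTranspose_mul, unitary_mul_conjTranspose, one_kronecker_one, Matrix.mul_one,
      embed_conjTranspose_mul_self hd]
  have hover := S.recovery_conjTranspose_mul i 0 1
  rw [embed_conjTranspose_mul_mul_embed] at hover
  have hunit : ((S.unitary i 0 : Matrix (Fin d) (Fin d) ℂ) *
      (S.unitary i 1 : Matrix (Fin d) (Fin d) ℂ)ᴴ)ᵀ * (((S.unitary i 0 : Matrix (Fin d) (Fin d) ℂ) *
      (S.unitary i 1 : Matrix (Fin d) (Fin d) ℂ)ᴴ)ᵀ)ᴴ = 1 := by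
    have hU := (S.unitary i 0 * (S.unitary i 1)⁻¹).2
    have := mem_unitaryGroup_iff'.1 hU
    rw [conjTranspose_transpose_eq_transpose_conjTranspose, ← transpose_mul, transpose_eq_one]
    exact this
  exact posSemidef_smul_one_sub_of_isometry (hiso 0) (hiso 1) hover hunit hc.le hp.1
    (sub_nonneg.2 hp.2) (by linarith) (by linarith) (by linarith)
    (by linear_combination (1 / 4) * hS2)

theorem successProb_le_bound (hd : 1 ≤ d) {p : ℝ} (hp : p ∈ Set.Icc (0 : ℝ) 1)
    (S : Strategy d m K) : S.successProb p ≤ bound d p := by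
  have hsum : ∑ i, (S.afterOutcome i).trace.re = 1 := by
    rw [← Complex.re_sum, sum_trace_afterOutcome hd, Complex.one_re]
  have hle : ∀ i, p * (S.recovery i 0 * (S.recovery i 0)ᴴ * S.afterOutcome i).trace.re +
      (1 - p) * (S.recovery i 1 * (S.recovery i 1)ᴴ * S.afterOutcome i).trace.re ≤
      bound d p * (S.afterOutcome i).trace.re := fun i => by
    have h := (Complex.le_def.1
      (S.trace_mul_afterOutcome_nonneg i (S.posSemidef_bound_sub hd hp i))).1
    simp only [Matrix.sub_mul, Matrix.add_mul, Matrix.smul_mul, Matrix.one_mul, trace_sub,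
      trace_add, trace_smul, smul_eq_mul, Complex.sub_re, Complex.add_re, Complex.re_ofReal_mul,
      Complex.zero_re] at h
    linarith
  rw [successProb, fidelity_eq_sum, fidelity_eq_sum, Finset.mul_sum, Finset.mul_sum,
    ← Finset.sum_add_distrib]
  refine (Finset.sum_le_sum fun i _ => hle i).trans_eq ?_
  rw [← Finset.mul_sum, hsum, mul_one]

end Strategy

end CNSQRAC

theorem mainTheorem5 (d : ℕ) (hd : 1 ≤ d) (p : ℝ) (hp : p ∈ Set.Icc (0 : ℝ) 1) :
    (∀ (m K : ℕ) (S : CNSQRAC.Strategy d m K), S.successProb p ≤ CNSQRAC.bound d p) ∧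
      IsGreatest ((fun z : ℝ × ℝ => p * z.1 ^ 2 + (1 - p) * z.2 ^ 2) '' CNSQRAC.feasible d)
        (CNSQRAC.bound d p) :=
  ⟨fun _ _ S => S.successProb_le_bound hd hp, CNSQRAC.isGreatest_bound hd hp⟩
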